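/- \textbf{Theorem} (The equivalent algebraic semantics of $\mathsf{MALL}$ is the variety of bounded Girard algebras). Formulas are built from countably many variables with the connectives $\to,\cdot,\wedge,\vee$ (binary), $\neg$ (unary) and the constants $0,1,\top,\bot$. Let $\Gamma\vdash_{\mathsf{MALL}}\varphi$ mean that $\varphi$ is derivable from $\Gamma$ by the rules (MP) $p,\ p\to q\ /\ q$ and (Adj) $p,\ q\ /\ p\wedge q$ from all instances of the axioms (HL1) $p\to p$; (HL2) $(p\to q)\to((q\to r)\to(p\to r))$; (HL3) $(p\to(q\to r))\to(q\to(p\to r))$; (HL4) $\neg\neg p\to p$; (HL5) $(p\to\neg q)\to(q\to\neg p)$; (HL6) $p\to(q\to p\cdot q)$; (HL7) $(p\to(q\to r))\to(p\cdot q\to r)$; (HL8) $1$; (HL9) $1\to(p\to p)$; (HL10) $p\to(\neg p\to 0)$; (HL11) $\neg 0$; (HL12) $p\wedge q\to p$; (HL13) $p\wedge q\to q$; (HL14) $(p\to q)\wedge(p\to r)\to(p\to q\wedge r)$; (HL15) $p\to p\vee q$; (HL16) $q\to p\vee q$; (HL17) $(p\to r)\wedge(q\to r)\to(p\vee q\to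 r)$; (HL18) $p\to\top$; (HL19) $\bot\to p$. A \emph{bounded Girard algebra} is an algebra $\langle A,\vee,\wedge,\to,\cdot,0,1,\top\rangle$ such that $\langle A,\vee,\wedge\rangle$ is a lattice, $\langle A,\cdot,1\rangle$ is a commutative monoid, $a\cdot b\le c\iff b\le a\to c$, $(b\to 0)\to 0=b$ and $1\le b\to\top$ for all $a,b,c\in A$. It is regarded as an algebra in the language of $\mathsf{MALL}$ by putting $\neg x:=x\to 0$ and $\bot:=\neg\top$. For a class $K$ of algebras, $\Theta\models_K e$ means that in each algebra of $K$ every assignment satisfying all equations in $\Theta$ satisfies the equation $e$; for a set $E$ of equations, $\Theta\models_K E$ means $\Theta\models_K e$ for all $e\in E$. The class $K$ is an \emph{equivalent algebraic semantics} of a deductive system $\vdash$, with a finite set $\tau(p)$ of defining equations in one variable and a finite set $\Delta(p,q)$ of congruence formulas in two variables, if for all sets $\Gamma$ of formulas and all formulas $\varphi,\psi$, $$\Gamma\vdash\varphi\iff\bigcup_{\gamma\in\Gamma}\tau(\gamma)\models_K\tau(\varphi),\qquad \varphi\approx\psi\ \text{ and }\bigcup_{\chi\in\Delta(\varphi,\psi)}\tau(\chi)\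 \text{ imply each other under }\models_K .$$ The system is \emph{algebraizable} if such $K,\tau,\Delta$ exist. Then $\mathsf{MALL}$ is algebraizable. The class $\mathcal{BG}$ of bounded Girard algebras, in the language of $\mathsf{MALL}$, is a variety, and it is an equivalent algebraic semantics of $\mathsf{MALL}$ with defining equation $p\wedge 1\approx 1$ and congruence formulas $\{p\to q,\ q\to p\}$. It is the only quasivariety with this property: every quasivariety that is an equivalent algebraic semantics of $\mathsf{MALL}$, with respect to any finite $\tau$ and $\Delta$, equals $\mathcal{BG}$. -/

import Mathlib

universe u

/-! ## Deductive systems, varieties and algebraizability (Blok and Pigozzi)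

Formulas over a propositional language are the terms of a first-order language `L` without relation
symbols, over the countable set `ℕ` of variables; algebras of that type are the `L`-structures. -/

namespace AAL

open FirstOrder.Language

variable {L : FirstOrder.Language.{0, 0}}

/-- A 1-deductive system over `L`: a consequence relation between sets of formulas and formulas
that is reflexive, transitive (cut), finitary and structural (closed under substitutions).
Monotonicity is the special case of `cut` in which every formula of `Γ` is in `Γ'`. -/
structure DeductiveSystem (L : FirstOrder.Language.{0, 0}) where
  Proves : Set (L.Term ℕ) → L.Term ℕ → Prop
  refl : ∀ {Γ : Set (L.Term ℕ)} {φ : L.Term ℕ}, φ ∈ Γ → Proves Γ φ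
  cut : ∀ {Γ Γ' : Set (L.Term ℕ)} {φ : L.Term ℕ},
    Proves Γ φ → (∀ γ ∈ Γ, Proves Γ' γ) → Proves Γ' φ
  finitary : ∀ {Γ : Set (L.Term ℕ)} {φ : L.Term ℕ},
    Proves Γ φ → ∃ Γ₀ : Set (L.Term ℕ), Γ₀ ⊆ Γ ∧ Γ₀.Finite ∧ Proves Γ₀ φ
  structural : ∀ {Γ : Set (L.Term ℕ)} {φ : L.Term ℕ} (σ : ℕ → L.Term ℕ),
    Proves Γ φ → Proves ((fun γ => γ.subst σ) '' Γ) (φ.subst σ)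

/-- An equation `s ≈ t` between terms with variables in `α`. -/
structure Equation (L : FirstOrder.Language.{0, 0}) (α : Type) where
  lhs : L.Term α
  rhs : L.Term α

/-- The equation `e` is true in the algebra `A` under the assignment `v`. -/
def Equation.Holds {α : Type} (e : Equation L α) {A : Type u} [L.Structure A] (v : α → A) : Prop :=
  e.lhs.realize v = e.rhs.realize v

/-- Simultaneous substitution in both sides of an equation. -/
def Equation.subst {α β : Type} (e : Equation L α) (σ : α → L.Term β) : Equation L β :=
  ⟨e.lhs.subst σ, e.rhs.subst σ⟩

/-- A quasi-equation: finitely many equations imply an equation. -/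
structure QuasiEquation (L : FirstOrder.Language.{0, 0}) where
  premises : List (Equation L ℕ)
  conclusion : Equation L ℕ

/-- A class of algebras of type `L`. -/
abbrev AlgebraClass (L : FirstOrder.Language.{0, 0}) : Type (u + 1) :=
  ∀ (A : Type u) [L.Structure A], Prop

/-- A variety: a class of algebras axiomatized by a set of equations. -/
def IsVariety (K : AlgebraClass.{u} L) : Prop :=
  ∃ E : Set (Equation L ℕ), ∀ (A : Type u) [L.Structure A],
    K A ↔ ∀ e ∈ E, ∀ v : ℕ → A, e.Holds v

/-- A quasivariety: a class of algebras axiomatized by a set of quasi-equations. -/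
def IsQuasivariety (K : AlgebraClass.{u} L) : Prop :=
  ∃ Q : Set (QuasiEquation L), ∀ (A : Type u) [L.Structure A],
    K A ↔ ∀ q ∈ Q, ∀ v : ℕ → A, (∀ e ∈ q.premises, e.Holds v) → q.conclusion.Holds v

/-- The equational consequence relation `Θ ⊨_K e` of a class `K` of algebras. -/
def EqConsequence (K : AlgebraClass.{u} L) (Θ : Set (Equation L ℕ)) (e : Equation L ℕ) : Prop :=
  ∀ (A : Type u) [L.Structure A], K A → ∀ v : ℕ → A, (∀ d ∈ Θ, d.Holds v) → e.Holds v

/-- The set `τ(φ)` of equations `δ(φ) ≈ ε(φ)`, for `δ ≈ ε` in the set `τ` of equations in one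
variable. -/
def translate (τ : Set (Equation L (Fin 1))) (φ : L.Term ℕ) : Set (Equation L ℕ) :=
  (fun e => e.subst ![φ]) '' τ

/-- The set `Δ(φ, ψ)` of formulas, for a set `Δ` of formulas in two variables. -/
def equivFormulas (Δ : Set (L.Term (Fin 2))) (φ ψ : L.Term ℕ) : Set (L.Term ℕ) :=
  (fun d => d.subst ![φ, ψ]) '' Δ

/-- The class `K` is an equivalent algebraic semantics of `S`, with (finite) set `τ` of defining
equations and (finite) set `Δ` of equivalence (congruence) formulas:
`Γ ⊢ φ` iff `τ(Γ) ⊨_K τ(φ)`, and `φ ≈ ψ` is equivalent over `K` to `τ(Δ(φ, ψ))`. -/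
structure IsEquivalentAlgebraicSemantics (S : DeductiveSystem L) (K : AlgebraClass.{u} L)
    (τ : Set (Equation L (Fin 1))) (Δ : Set (L.Term (Fin 2))) : Prop where
  finite_defining : τ.Finite
  finite_equiv : Δ.Finite
  proves_iff : ∀ (Γ : Set (L.Term ℕ)) (φ : L.Term ℕ),
    S.Proves Γ φ ↔ ∀ e ∈ translate τ φ, EqConsequence K (⋃ γ ∈ Γ, translate τ γ) e
  of_eq : ∀ (φ ψ : L.Term ℕ), ∀ e ∈ ⋃ χ ∈ equivFormulas Δ φ ψ, translate τ χ,
    EqConsequence K {⟨φ, ψ⟩} e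
  to_eq : ∀ (φ ψ : L.Term ℕ),
    EqConsequence K (⋃ χ ∈ equivFormulas Δ φ ψ, translate τ χ) ⟨φ, ψ⟩

/-- A deductive system is algebraizable if it has an equivalent algebraic semantics. -/
def Algebraizable (S : DeductiveSystem L) : Prop :=
  ∃ (K : AlgebraClass.{u} L) (τ : Set (Equation L (Fin 1))) (Δ : Set (L.Term (Fin 2))),
    IsEquivalentAlgebraicSemantics S K τ Δ

end AAL

/-! ## The logic MALL -/

namespace MALL

open FirstOrder.Language

/-- The connectives of MALL, by arity (par is the abbreviation `¬p → q`). -/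
inductive Connective : ℕ → Type
  | zero : Connective 0
  | one : Connective 0
  | top : Connective 0
  | bot : Connective 0
  | neg : Connective 1
  | mul : Connective 2
  | imp : Connective 2
  | meet : Connective 2
  | join : Connective 2

/-- The propositional language of MALL. -/
def lang : FirstOrder.Language.{0, 0} := ⟨Connective, fun _ => Empty⟩

/-- Formulas of MALL with propositional variables in `α`. -/
abbrev Formula (α : Type) : Type := lang.Term α

namespace Formula

variable {α β : Type}

/-- The formula consisting of the single propositional variable `a`. -/
def var (a : α) : Formula α := Term.var a

instance : Zero (Formula α) := ⟨.func (l := 0) Connective.zero ![]⟩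
instance : One (Formula α) := ⟨.func (l := 0) Connective.one ![]⟩
instance : Top (Formula α) := ⟨.func (l := 0) Connective.top ![]⟩
instance : Bot (Formula α) := ⟨.func (l := 0) Connective.bot ![]⟩
/-- Linear negation, written `pᶜ`. -/
instance : Compl (Formula α) := ⟨fun p => .func (l := 1) Connective.neg ![p]⟩
/-- Multiplicative conjunction. -/
instance : Mul (Formula α) := ⟨fun p q => .func (l := 2) Connective.mul ![p, q]⟩
/-- Linear implication. -/
instance : HImp (Formula α) := ⟨fun p q => .func (l := 2) Connective.imp ![p, q]⟩
/-- Additive conjunction. -/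
instance : Min (Formula α) := ⟨fun p q => .func (l := 2) Connective.meet ![p, q]⟩
/-- Additive disjunction. -/
instance : Max (Formula α) := ⟨fun p q => .func (l := 2) Connective.join ![p, q]⟩

variable (σ : α → Formula β) (p q : Formula α)

theorem subst_zero : Term.subst (0 : Formula α) σ = (0 : Formula β) :=
  congrArg (Term.func (l := 0) (L := lang) Connective.zero) (by funext i; exact i.elim0)

theorem subst_one : Term.subst (1 : Formula α) σ = (1 : Formula β) :=
  congrArg (Term.func (l := 0) (L := lang) Connective.one) (by funext i; exact i.elim0)

theorem subst_top : Term.subst (⊤ : Formula α) σ = (⊤ : Formula β) :=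
  congrArg (Term.func (l := 0) (L := lang) Connective.top) (by funext i; exact i.elim0)

theorem subst_bot : Term.subst (⊥ : Formula α) σ = (⊥ : Formula β) :=
  congrArg (Term.func (l := 0) (L := lang) Connective.bot) (by funext i; exact i.elim0)

theorem subst_neg : Term.subst (pᶜ) σ = (Term.subst p σ)ᶜ :=
  congrArg (Term.func (l := 1) (L := lang) Connective.neg) (by funext i; fin_cases i; rfl)

theorem subst_mul : Term.subst (p * q) σ = Term.subst p σ * Term.subst q σ :=
  congrArg (Term.func (l := 2) (L := lang) Connective.mul) (by funext i; fin_cases i <;> rfl)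

theorem subst_imp : Term.subst (p ⇨ q) σ = Term.subst p σ ⇨ Term.subst q σ :=
  congrArg (Term.func (l := 2) (L := lang) Connective.imp) (by funext i; fin_cases i <;> rfl)

theorem subst_meet : Term.subst (p ⊓ q) σ = Term.subst p σ ⊓ Term.subst q σ :=
  congrArg (Term.func (l := 2) (L := lang) Connective.meet) (by funext i; fin_cases i <;> rfl)

theorem subst_join : Term.subst (p ⊔ q) σ = Term.subst p σ ⊔ Term.subst q σ :=
  congrArg (Term.func (l := 2) (L := lang) Connective.join) (by funext i; fin_cases i <;> rfl)

end Formula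

/-- The axioms (HL1)-(HL19), as schemes. -/
inductive IsAxiom : Formula ℕ → Prop
  | hl1 (p : Formula ℕ) : IsAxiom (p ⇨ p)
  | hl2 (p q r : Formula ℕ) : IsAxiom ((p ⇨ q) ⇨ ((q ⇨ r) ⇨ (p ⇨ r)))
  | hl3 (p q r : Formula ℕ) : IsAxiom ((p ⇨ (q ⇨ r)) ⇨ (q ⇨ (p ⇨ r)))
  | hl4 (p : Formula ℕ) : IsAxiom (pᶜᶜ ⇨ p)
  | hl5 (p q : Formula ℕ) : IsAxiom ((p ⇨ qᶜ) ⇨ (q ⇨ pᶜ))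
  | hl6 (p q : Formula ℕ) : IsAxiom (p ⇨ (q ⇨ (p * q)))
  | hl7 (p q r : Formula ℕ) : IsAxiom ((p ⇨ (q ⇨ r)) ⇨ ((p * q) ⇨ r))
  | hl8 : IsAxiom 1
  | hl9 (p : Formula ℕ) : IsAxiom (1 ⇨ (p ⇨ p))
  | hl10 (p : Formula ℕ) : IsAxiom (p ⇨ (pᶜ ⇨ 0))
  | hl11 : IsAxiom (0ᶜ)
  | hl12 (p q : Formula ℕ) : IsAxiom ((p ⊓ q) ⇨ p)
  | hl13 (p q : Formula ℕ) : IsAxiom ((p ⊓ q) ⇨ q)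
  | hl14 (p q r : Formula ℕ) : IsAxiom (((p ⇨ q) ⊓ (p ⇨ r)) ⇨ (p ⇨ (q ⊓ r)))
  | hl15 (p q : Formula ℕ) : IsAxiom (p ⇨ (p ⊔ q))
  | hl16 (p q : Formula ℕ) : IsAxiom (q ⇨ (p ⊔ q))
  | hl17 (p q r : Formula ℕ) : IsAxiom (((p ⇨ r) ⊓ (q ⇨ r)) ⇨ ((p ⊔ q) ⇨ r))
  | hl18 (p : Formula ℕ) : IsAxiom (p ⇨ ⊤)
  | hl19 (p : Formula ℕ) : IsAxiom (⊥ ⇨ p)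

/-- Hilbert-style derivability from the hypotheses `Γ`, with the rules modus ponens and
adjunction. -/
inductive Derives (Γ : Set (Formula ℕ)) : Formula ℕ → Prop
  | hyp {p : Formula ℕ} : p ∈ Γ → Derives Γ p
  | ax {p : Formula ℕ} : IsAxiom p → Derives Γ p
  | mp {p q : Formula ℕ} : Derives Γ p → Derives Γ (p ⇨ q) → Derives Γ q
  | adj {p q : Formula ℕ} : Derives Γ p → Derives Γ q → Derives Γ (p ⊓ q)

theorem IsAxiom.subst {p : Formula ℕ} (h : IsAxiom p) (σ : ℕ → Formula ℕ) :
    IsAxiom (Term.subst p σ) := by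
  cases h <;>
    simp only [Formula.subst_zero, Formula.subst_one, Formula.subst_top, Formula.subst_bot,
      Formula.subst_neg, Formula.subst_mul, Formula.subst_imp, Formula.subst_meet,
      Formula.subst_join] <;>
    constructor

theorem Derives.cut {Γ Γ' : Set (Formula ℕ)} {p : Formula ℕ} (h : Derives Γ p)
    (hΓ : ∀ γ ∈ Γ, Derives Γ' γ) : Derives Γ' p := by
  induction h with
  | hyp h => exact hΓ _ h
  | ax h => exact .ax h
  | mp _ _ ih₁ ih₂ => exact .mp ih₁ ih₂
  | adj _ _ ih₁ ih₂ => exact .adj ih₁ ih₂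

theorem Derives.mono {Γ Γ' : Set (Formula ℕ)} {p : Formula ℕ} (h : Derives Γ p) (hΓ : Γ ⊆ Γ') :
    Derives Γ' p :=
  h.cut fun _ hγ => .hyp (hΓ hγ)

theorem Derives.finitary {Γ : Set (Formula ℕ)} {p : Formula ℕ} (h : Derives Γ p) :
    ∃ Γ₀ : Set (Formula ℕ), Γ₀ ⊆ Γ ∧ Γ₀.Finite ∧ Derives Γ₀ p := by
  induction h with
  | @hyp p h => exact ⟨{p}, by simpa using h, Set.finite_singleton p, .hyp rfl⟩
  | ax h => exact ⟨∅, Set.empty_subset _, Set.finite_empty, .ax h⟩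
  | mp _ _ ih₁ ih₂ =>
    obtain ⟨Γ₁, s₁, f₁, d₁⟩ := ih₁
    obtain ⟨Γ₂, s₂, f₂, d₂⟩ := ih₂
    exact ⟨Γ₁ ∪ Γ₂, Set.union_subset s₁ s₂, f₁.union f₂,
      .mp (d₁.mono Set.subset_union_left) (d₂.mono Set.subset_union_right)⟩
  | adj _ _ ih₁ ih₂ =>
    obtain ⟨Γ₁, s₁, f₁, d₁⟩ := ih₁
    obtain ⟨Γ₂, s₂, f₂, d₂⟩ := ih₂
    exact ⟨Γ₁ ∪ Γ₂, Set.union_subset s₁ s₂, f₁.union f₂,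
      .adj (d₁.mono Set.subset_union_left) (d₂.mono Set.subset_union_right)⟩

theorem Derives.structural {Γ : Set (Formula ℕ)} {p : Formula ℕ} (σ : ℕ → Formula ℕ)
    (h : Derives Γ p) : Derives ((fun γ => Term.subst γ σ) '' Γ) (Term.subst p σ) := by
  induction h with
  | hyp h => exact .hyp (Set.mem_image_of_mem _ h)
  | ax h => exact .ax (h.subst σ)
  | mp _ _ ih₁ ih₂ => exact .mp ih₁ (by rwa [Formula.subst_imp] at ih₂)
  | adj _ _ ih₁ ih₂ => rw [Formula.subst_meet]; exact .adj ih₁ ih₂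

/-- MALL as a deductive system. -/
def system : AAL.DeductiveSystem lang where
  Proves := Derives
  refl := .hyp
  cut := Derives.cut
  finitary := Derives.finitary
  structural := Derives.structural

/-- The defining equation `p ∧ 1 ≈ 1`. -/
def definingEquations : Set (AAL.Equation lang (Fin 1)) :=
  {⟨Formula.var 0 ⊓ 1, 1⟩}

/-- The congruence formulas `p → q` and `q → p`. -/
def congruenceFormulas : Set (Formula (Fin 2)) :=
  {Formula.var 0 ⇨ Formula.var 1, Formula.var 1 ⇨ Formula.var 0}

end MALL

/-! ## Bounded Girard algebras -/

/-- A commutative residuated lattice. The residual is written `a ⇨ b`. -/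
class CommResiduatedLattice (A : Type u) extends Lattice A, CommMonoid A, HImp A where
  residuation : ∀ a b c : A, a * b ≤ c ↔ b ≤ a ⇨ c

/-- A Girard algebra: a commutative residuated lattice with an involutive element `0`. -/
class GirardAlgebra (A : Type u) extends CommResiduatedLattice A, Zero A where
  involutive : ∀ b : A, (b ⇨ (0 : A)) ⇨ 0 = b

/-- A bounded Girard algebra: a Girard algebra with a constant `⊤` with `x → ⊤ ≥ 1` for all `x`. -/
class BoundedGirardAlgebra (A : Type u) extends GirardAlgebra A, Top A where
  one_le_himp_top : ∀ x : A, (1 : A) ≤ x ⇨ ⊤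

namespace BoundedGirardAlgebra

/-- A bounded Girard algebra as an algebra in the language of MALL: the basic operations interpret
the connectives of the same name, and `¬x := x → 0`, `⊥ := ¬⊤`. -/
@[reducible]
def mallStructure {A : Type u} (_ : BoundedGirardAlgebra A) : MALL.lang.Structure A where
  funMap := fun {n} (f : MALL.Connective n) =>
    match n, f with
    | _, .zero => fun _ => 0
    | _, .one => fun _ => 1
    | _, .top => fun _ => ⊤
    | _, .bot => fun _ => ⊤ ⇨ 0
    | _, .neg => fun x => x 0 ⇨ 0
    | _, .mul => fun x => x 0 * x 1
    | _, .imp => fun x => x 0 ⇨ x 1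
    | _, .meet => fun x => x 0 ⊓ x 1
    | _, .join => fun x => x 0 ⊔ x 1
  RelMap := fun r => r.elim

/-- The class of bounded Girard algebras, as a class of algebras in the language of MALL. -/
def asClass : AAL.AlgebraClass.{u} MALL.lang :=
  fun (A : Type u) [s : MALL.lang.Structure A] => ∃ B : BoundedGirardAlgebra A, s = B.mallStructure

end BoundedGirardAlgebra

/-!
In a class `K` that is an equivalent algebraic semantics of `⊢`, an equation `φ ≈ ψ` holds exactly
when the formulas of `Δ(φ, ψ)` are designated, so `Θ ⊨_K φ ≈ ψ` says that `Δ(φ, ψ)` is derivable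
from `⋃ Δ(Θ)`. Two sets of congruence formulas are interderivable, since `⊢ Δ(φ, φ)` and the other
set forces `φ` and `ψ` to have the same value. Hence all equivalent algebraic semantics of `⊢` have
the same consequence relation, and those that are quasivarieties coincide.

That bounded Girard algebras form one for MALL is soundness together with completeness, the latter
because the formulas modulo interderivability over `Γ` are a bounded Girard algebra in which the
classes above `1` are exactly those of the consequences of `Γ`. They form a variety because, in a
lattice, residuation amounts to the two inequalities `b ≤ a ⇨ (a * b ⊔ c)` and
`a * ((a ⇨ c) ⊓ b) ≤ c`.
-/

namespace AAL

open FirstOrder.Language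

variable {L : FirstOrder.Language.{0, 0}}

theorem Equation.holds_subst {α β : Type} (e : Equation L α) (σ : α → L.Term β) {A : Type u}
    [L.Structure A] (v : β → A) : (e.subst σ).Holds v ↔ e.Holds (Term.realize v ∘ σ) := by
  simp only [Equation.Holds, Equation.subst, Term.realize_subst, Function.comp_def]

section Varieties

variable {K K' : AlgebraClass.{u} L}

theorem isVariety_of_countable {α : Type} [Countable α] (E : Set (Equation L α))
    (hK : ∀ (A : Type u) [L.Structure A], K A ↔ ∀ e ∈ E, ∀ v : α → A, e.Holds v) :
    IsVariety K := by
  obtain ⟨f, hf⟩ := Countable.exists_injective_nat α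
  refine ⟨(fun e => e.subst (Term.var ∘ f)) '' E, fun A _ => ?_⟩
  simp only [hK, Set.forall_mem_image, Equation.holds_subst]
  refine forall₂_congr fun e _ => ⟨fun h v => h _, fun h v => ?_⟩
  simpa only [Function.comp_def, Term.realize_var, hf.extend_apply] using
    h (Function.extend f v fun _ => e.lhs.realize v)

theorem IsVariety.isQuasivariety (hK : IsVariety K) : IsQuasivariety K := by
  obtain ⟨E, hE⟩ := hK
  refine ⟨(fun e => ⟨[], e⟩) '' E, fun A _ => ?_⟩
  simp [hE]

theorem IsQuasivariety.of_eqConsequence_imp (hK : IsQuasivariety K)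
    (h : ∀ (Θ : Set (Equation L ℕ)) (e : Equation L ℕ), Θ.Finite →
      EqConsequence K Θ e → EqConsequence K' Θ e)
    (A : Type u) [L.Structure A] (hA : K' A) : K A := by
  obtain ⟨Q, hQ⟩ := hK
  refine (hQ A).2 fun q hq v hv => ?_
  exact h {e | e ∈ q.premises} q.conclusion q.premises.finite_toSet
    (fun B _ hB w hw => (hQ B).1 hB q hq w hw) A hA v hv

end Varieties

section Designated

variable {A : Type u} [L.Structure A]

/-- The elements that satisfy the defining equations `τ`, i.e. the designated elements of the
algebra as a logical matrix: `τ(φ)` holds under an assignment iff the value of `φ` is designated. -/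
def IsDesignated (τ : Set (Equation L (Fin 1))) (a : A) : Prop :=
  ∀ e ∈ τ, e.Holds ![a]

variable {K : AlgebraClass.{u} L} {τ : Set (Equation L (Fin 1))}

theorem forall_translate_holds_iff {φ : L.Term ℕ} {v : ℕ → A} :
    (∀ e ∈ translate τ φ, e.Holds v) ↔ IsDesignated τ (φ.realize v) := by
  have realize_singleton : Term.realize v ∘ ![φ] = ![φ.realize v] :=
    (FinVec.map_eq (Term.realize v) ![φ]).symm
  simp only [translate, IsDesignated, Set.forall_mem_image, Equation.holds_subst,
    realize_singleton]

theorem forall_biUnion_translate_holds_iff {Γ : Set (L.Term ℕ)} {v : ℕ → A} :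
    (∀ e ∈ ⋃ γ ∈ Γ, translate τ γ, e.Holds v) ↔ ∀ γ ∈ Γ, IsDesignated τ (γ.realize v) := by
  simp only [← forall_translate_holds_iff, Set.mem_iUnion₂]
  exact ⟨fun h γ hγ e he => h e ⟨γ, hγ, he⟩, fun h e ⟨γ, hγ, he⟩ => h γ hγ e he⟩

theorem forall_eqConsequence_translate_iff {Γ : Set (L.Term ℕ)} {φ : L.Term ℕ} :
    (∀ e ∈ translate τ φ, EqConsequence K (⋃ γ ∈ Γ, translate τ γ) e) ↔
      ∀ (A : Type u) [L.Structure A], K A → ∀ v : ℕ → A,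
        (∀ γ ∈ Γ, IsDesignated τ (γ.realize v)) → IsDesignated τ (φ.realize v) := by
  simp only [← forall_translate_holds_iff (φ := φ), ← forall_biUnion_translate_holds_iff]
  exact ⟨fun h A _ hA v hv e he => h e he A hA v hv, fun h e he A _ hA v hv => h A hA v hv e he⟩

theorem forall_equivFormulas_isDesignated_iff {Δ : Set (L.Term (Fin 2))} {φ ψ : L.Term ℕ}
    {v : ℕ → A} :
    (∀ χ ∈ equivFormulas Δ φ ψ, IsDesignated τ (χ.realize v)) ↔
      ∀ d ∈ Δ, IsDesignated τ (d.realize ![φ.realize v, ψ.realize v]) := by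
  have realize_pair : (fun i => (![φ, ψ] i).realize v) = ![φ.realize v, ψ.realize v] :=
    (FinVec.map_eq (Term.realize v) ![φ, ψ]).symm
  simp only [equivFormulas, Set.forall_mem_image, Term.realize_subst, realize_pair]

end Designated

namespace IsEquivalentAlgebraicSemantics

variable {S : DeductiveSystem L} {K : AlgebraClass.{u} L} {τ : Set (Equation L (Fin 1))}
  {Δ : Set (L.Term (Fin 2))}

theorem of_isDesignated (hτ : τ.Finite) (hΔ : Δ.Finite)
    (proves_iff : ∀ (Γ : Set (L.Term ℕ)) (φ : L.Term ℕ), S.Proves Γ φ ↔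
      ∀ (A : Type u) [L.Structure A], K A → ∀ v : ℕ → A,
        (∀ γ ∈ Γ, IsDesignated τ (γ.realize v)) → IsDesignated τ (φ.realize v))
    (eq_iff : ∀ (A : Type u) [L.Structure A], K A → ∀ a b : A,
      a = b ↔ ∀ d ∈ Δ, IsDesignated τ (d.realize ![a, b])) :
    IsEquivalentAlgebraicSemantics S K τ Δ where
  finite_defining := hτ
  finite_equiv := hΔ
  proves_iff Γ φ := (proves_iff Γ φ).trans forall_eqConsequence_translate_iff.symm
  of_eq φ ψ e he A _ hA v hv := by
    refine forall_biUnion_translate_holds_iff.2 ?_ e he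
    exact forall_equivFormulas_isDesignated_iff.2 ((eq_iff A hA _ _).1 (hv _ rfl))
  to_eq φ ψ A _ hA v hv := (eq_iff A hA _ _).2 <|
    forall_equivFormulas_isDesignated_iff.1 (forall_biUnion_translate_holds_iff.1 hv)

theorem proves_iff_isDesignated (h : IsEquivalentAlgebraicSemantics S K τ Δ)
    {Γ : Set (L.Term ℕ)} {φ : L.Term ℕ} :
    S.Proves Γ φ ↔ ∀ (A : Type u) [L.Structure A], K A → ∀ v : ℕ → A,
      (∀ γ ∈ Γ, IsDesignated τ (γ.realize v)) → IsDesignated τ (φ.realize v) :=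
  (h.proves_iff Γ φ).trans forall_eqConsequence_translate_iff

theorem holds_iff (h : IsEquivalentAlgebraicSemantics S K τ Δ) {A : Type u} [L.Structure A]
    (hA : K A) {v : ℕ → A} {e : Equation L ℕ} :
    e.Holds v ↔ ∀ χ ∈ equivFormulas Δ e.lhs e.rhs, IsDesignated τ (χ.realize v) := by
  rw [← forall_biUnion_translate_holds_iff]
  refine ⟨fun hv d hd => h.of_eq e.lhs e.rhs d hd A hA v ?_, h.to_eq e.lhs e.rhs A hA v⟩
  rintro _ rfl
  exact hv

theorem proves_equivFormulas_self (h : IsEquivalentAlgebraicSemantics S K τ Δ)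
    {Γ : Set (L.Term ℕ)} {φ χ : L.Term ℕ} (hχ : χ ∈ equivFormulas Δ φ φ) : S.Proves Γ χ :=
  h.proves_iff_isDesignated.2 fun _ _ hA _ _ => (h.holds_iff hA (e := ⟨φ, φ⟩)).1 rfl χ hχ

theorem eqConsequence_iff_proves (h : IsEquivalentAlgebraicSemantics S K τ Δ)
    {Θ : Set (Equation L ℕ)} {e : Equation L ℕ} :
    EqConsequence K Θ e ↔ ∀ χ ∈ equivFormulas Δ e.lhs e.rhs,
      S.Proves (⋃ d ∈ Θ, equivFormulas Δ d.lhs d.rhs) χ := by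
  have holds_premises_iff {A : Type u} [L.Structure A] (hA : K A) (v : ℕ → A) :
      (∀ χ ∈ ⋃ d ∈ Θ, equivFormulas Δ d.lhs d.rhs, IsDesignated τ (χ.realize v)) ↔
        ∀ d ∈ Θ, d.Holds v := by
    simp only [h.holds_iff hA, Set.mem_iUnion₂]
    exact ⟨fun H d hd χ hχ => H χ ⟨d, hd, hχ⟩, fun H χ ⟨d, hd, hχ⟩ => H d hd χ hχ⟩
  simp only [h.proves_iff_isDesignated]
  constructor
  · intro H χ hχ A _ hA v hv
    exact (h.holds_iff hA).1 (H A hA v ((holds_premises_iff hA v).1 hv)) χ hχ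
  · intro H A _ hA v hv
    exact (h.holds_iff hA).2 fun χ hχ => H χ hχ A hA v ((holds_premises_iff hA v).2 hv)

universe w

variable {K' : AlgebraClass.{w} L} {τ' : Set (Equation L (Fin 1))} {Δ' : Set (L.Term (Fin 2))}

theorem proves_equivFormulas (h : IsEquivalentAlgebraicSemantics S K τ Δ)
    (h' : IsEquivalentAlgebraicSemantics S K' τ' Δ') {φ ψ χ : L.Term ℕ}
    (hχ : χ ∈ equivFormulas Δ φ ψ) : S.Proves (equivFormulas Δ' φ ψ) χ := by
  refine h'.proves_iff_isDesignated.2 fun A _ hA v hv => ?_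
  have realize_eq : φ.realize v = ψ.realize v := (h'.holds_iff hA (e := ⟨φ, ψ⟩)).2 hv
  have self_designated : ∀ ξ ∈ equivFormulas Δ φ φ, IsDesignated τ' (ξ.realize v) := fun ξ hξ =>
    h'.proves_iff_isDesignated.1 (h.proves_equivFormulas_self (Γ := ∅) hξ) A hA v
      fun _ hγ => hγ.elim
  refine forall_equivFormulas_isDesignated_iff.2 ?_ χ hχ
  rw [← realize_eq]
  exact forall_equivFormulas_isDesignated_iff.1 self_designated

theorem eqConsequence_imp (h : IsEquivalentAlgebraicSemantics S K τ Δ)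
    (h' : IsEquivalentAlgebraicSemantics S K' τ' Δ') {Θ : Set (Equation L ℕ)} {e : Equation L ℕ}
    (H : EqConsequence K Θ e) : EqConsequence K' Θ e := by
  rw [h.eqConsequence_iff_proves] at H
  refine h'.eqConsequence_iff_proves.2 fun χ hχ => ?_
  refine S.cut (S.cut (h'.proves_equivFormulas h hχ) H) fun γ hγ => ?_
  obtain ⟨d, hd, hγ⟩ := Set.mem_iUnion₂.1 hγ
  exact S.cut (h.proves_equivFormulas h' hγ) fun ξ hξ => S.refl (Set.mem_biUnion hd hξ)

theorem iff_of_isQuasivariety {K' : AlgebraClass.{u} L}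
    (h : IsEquivalentAlgebraicSemantics S K τ Δ) (h' : IsEquivalentAlgebraicSemantics S K' τ' Δ')
    (hK : IsQuasivariety K) (hK' : IsQuasivariety K') (A : Type u) [L.Structure A] :
    K A ↔ K' A :=
  ⟨hK'.of_eqConsequence_imp (fun _ _ _ => h'.eqConsequence_imp h) A,
    hK.of_eqConsequence_imp (fun _ _ _ => h.eqConsequence_imp h') A⟩

end IsEquivalentAlgebraicSemantics

end AAL

namespace CommResiduatedLattice

variable {A : Type u} [CommResiduatedLattice A] {a b c : A}

theorem le_himp_iff_mul_le : b ≤ a ⇨ c ↔ a * b ≤ c :=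
  (residuation a b c).symm

theorem mul_himp_le (a b : A) : a * (a ⇨ b) ≤ b :=
  le_himp_iff_mul_le.1 le_rfl

theorem one_le_himp_iff : 1 ≤ a ⇨ b ↔ a ≤ b := by
  rw [le_himp_iff_mul_le, mul_one]

theorem le_himp_iff_le_himp : a ≤ b ⇨ c ↔ b ≤ a ⇨ c := by
  rw [le_himp_iff_mul_le, le_himp_iff_mul_le, mul_comm]

instance : MulLeftMono A :=
  ⟨fun _ _ _ h => le_himp_iff_mul_le.1 (h.trans (le_himp_iff_mul_le.2 le_rfl))⟩

theorem mul_himp (a b c : A) : a * b ⇨ c = a ⇨ b ⇨ c :=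
  eq_of_forall_le_iff fun d => by
    simp only [le_himp_iff_mul_le, mul_left_comm b a d, mul_assoc]

protected theorem himp_left_comm (a b c : A) : a ⇨ b ⇨ c = b ⇨ a ⇨ c := by
  rw [← mul_himp, mul_comm, mul_himp]

theorem himp_le_himp_himp (a b c : A) : a ⇨ b ≤ (b ⇨ c) ⇨ a ⇨ c := by
  rw [le_himp_iff_mul_le, le_himp_iff_mul_le, mul_left_comm]
  calc (b ⇨ c) * (a * (a ⇨ b)) ≤ (b ⇨ c) * b := mul_le_mul_right (mul_himp_le a b) _
    _ = b * (b ⇨ c) := mul_comm _ _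
    _ ≤ c := mul_himp_le b c

protected theorem himp_inf_distrib (a b c : A) : a ⇨ b ⊓ c = (a ⇨ b) ⊓ (a ⇨ c) :=
  eq_of_forall_le_iff fun d => by simp only [le_himp_iff_mul_le, le_inf_iff]

protected theorem sup_himp_distrib (a b c : A) : a ⊔ b ⇨ c = (a ⇨ c) ⊓ (b ⇨ c) :=
  eq_of_forall_le_iff fun d => by simp only [le_himp_iff_le_himp (a := d), sup_le_iff, le_inf_iff]

end CommResiduatedLattice

namespace BoundedGirardAlgebra

open CommResiduatedLattice

variable {A : Type u} [BoundedGirardAlgebra A]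

instance : OrderTop A where
  le_top a := one_le_himp_iff.1 (one_le_himp_top a)

theorem top_himp_zero_le (a : A) : ⊤ ⇨ 0 ≤ a := by
  rw [← GirardAlgebra.involutive a, le_himp_iff_le_himp, GirardAlgebra.involutive]
  exact le_top

end BoundedGirardAlgebra

namespace MALL

open FirstOrder.Language

namespace Formula

variable {α : Type}

@[elab_as_elim]
theorem induction {motive : Formula α → Prop} (var : ∀ a, motive (var a))
    (zero : motive 0) (one : motive 1) (top : motive ⊤) (bot : motive ⊥)
    (neg : ∀ p, motive p → motive pᶜ)
    (mul : ∀ p q, motive p → motive q → motive (p * q))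
    (imp : ∀ p q, motive p → motive q → motive (p ⇨ q))
    (meet : ∀ p q, motive p → motive q → motive (p ⊓ q))
    (join : ∀ p q, motive p → motive q → motive (p ⊔ q)) (p : Formula α) : motive p := by
  induction p with
  | var a => exact var a
  | @func n f ts ih =>
    change Connective n at f
    rw [← FinVec.etaExpand_eq ts]
    cases f with
    | zero => exact zero
    | one => exact one
    | top => exact top
    | bot => exact bot
    | neg => exact neg _ (ih 0)
    | mul => exact mul _ _ (ih 0) (ih 1)
    | imp => exact imp _ _ (ih 0) (ih 1)
    | meet => exact meet _ _ (ih 0) (ih 1)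
    | join => exact join _ _ (ih 0) (ih 1)

end Formula

theorem structure_ext {A : Type u} {S T : lang.Structure A}
    (nullary : ∀ f : Connective 0, S.funMap (n := 0) f ![] = T.funMap (n := 0) f ![])
    (unary : ∀ (f : Connective 1) (a : A),
      S.funMap (n := 1) f ![a] = T.funMap (n := 1) f ![a])
    (binary : ∀ (f : Connective 2) (a b : A),
      S.funMap (n := 2) f ![a, b] = T.funMap (n := 2) f ![a, b]) : S = T := by
  refine Structure.ext (funext₃ fun n f x => ?_) (funext₂ fun _ r => r.elim)
  rw [← FinVec.etaExpand_eq x]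
  match n, f with
  | 0, f => exact nullary f
  | 1, f => exact unary f _
  | 2, f => exact binary f _ _

namespace Derives

variable {Γ : Set (Formula ℕ)} {p p' q q' r s : Formula ℕ}

theorem imp_self (p : Formula ℕ) : Derives Γ (p ⇨ p) :=
  .ax (.hl1 p)

theorem imp_trans (h₁ : Derives Γ (p ⇨ q)) (h₂ : Derives Γ (q ⇨ r)) : Derives Γ (p ⇨ r) :=
  .mp h₂ (.mp h₁ (.ax (.hl2 p q r)))

theorem imp_swap (h : Derives Γ (p ⇨ q ⇨ r)) : Derives Γ (q ⇨ p ⇨ r) :=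
  .mp h (.ax (.hl3 p q r))

theorem imp_mono (h₁ : Derives Γ (p' ⇨ p)) (h₂ : Derives Γ (q ⇨ q')) :
    Derives Γ ((p ⇨ q) ⇨ p' ⇨ q') :=
  imp_trans (.mp h₁ (.ax (.hl2 p' p q))) (.mp h₂ (imp_swap (.ax (.hl2 p' q q'))))

theorem mul_imp_iff : Derives Γ (p * q ⇨ r) ↔ Derives Γ (p ⇨ q ⇨ r) :=
  ⟨fun h => imp_trans (.ax (.hl6 p q)) (imp_mono (imp_self q) h),
    fun h => .mp h (.ax (.hl7 p q r))⟩

theorem mul_mono (h₁ : Derives Γ (p ⇨ p')) (h₂ : Derives Γ (q ⇨ q')) :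
    Derives Γ (p * q ⇨ p' * q') :=
  mul_imp_iff.2 (h₁.imp_trans (imp_trans (.ax (.hl6 p' q')) (imp_mono h₂ (imp_self _))))

theorem mul_comm (p q : Formula ℕ) : Derives Γ (p * q ⇨ q * p) :=
  mul_imp_iff.2 (imp_swap (.ax (.hl6 q p)))

theorem mul_mul_imp_iff : Derives Γ (p * q * r ⇨ s) ↔ Derives Γ (p * (q * r) ⇨ s) := by
  rw [mul_imp_iff, mul_imp_iff, mul_imp_iff]
  exact ⟨fun h => imp_swap (mul_imp_iff.2 (h.imp_swap.imp_trans (.ax (.hl3 p r s)))),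
    fun h => imp_swap ((mul_imp_iff.1 h.imp_swap).imp_trans (.ax (.hl3 r p s)))⟩

theorem imp_one_imp (p : Formula ℕ) : Derives Γ (p ⇨ 1 ⇨ p) :=
  imp_swap (.ax (.hl9 p))

theorem one_imp_iff : Derives Γ (1 ⇨ p) ↔ Derives Γ p :=
  ⟨fun h => .mp (.ax .hl8) h, fun h => .mp h (imp_one_imp p)⟩

theorem mul_one_imp (p : Formula ℕ) : Derives Γ (p * 1 ⇨ p) :=
  mul_imp_iff.2 (imp_one_imp p)

theorem imp_mul_one (p : Formula ℕ) : Derives Γ (p ⇨ p * 1) :=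
  .mp (.ax .hl8) (imp_swap (.ax (.hl6 p 1)))

theorem imp_meet (h₁ : Derives Γ (p ⇨ q)) (h₂ : Derives Γ (p ⇨ r)) : Derives Γ (p ⇨ q ⊓ r) :=
  .mp (.adj h₁ h₂) (.ax (.hl14 p q r))

theorem join_imp (h₁ : Derives Γ (p ⇨ r)) (h₂ : Derives Γ (q ⇨ r)) : Derives Γ (p ⊔ q ⇨ r) :=
  .mp (.adj h₁ h₂) (.ax (.hl17 p q r))

theorem meet_mono (h₁ : Derives Γ (p ⇨ p')) (h₂ : Derives Γ (q ⇨ q')) :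
    Derives Γ (p ⊓ q ⇨ p' ⊓ q') :=
  imp_meet (imp_trans (.ax (.hl12 p q)) h₁) (imp_trans (.ax (.hl13 p q)) h₂)

theorem join_mono (h₁ : Derives Γ (p ⇨ p')) (h₂ : Derives Γ (q ⇨ q')) :
    Derives Γ (p ⊔ q ⇨ p' ⊔ q') :=
  join_imp (h₁.imp_trans (.ax (.hl15 p' q'))) (h₂.imp_trans (.ax (.hl16 p' q')))

theorem neg_imp_imp_zero (p : Formula ℕ) : Derives Γ (pᶜ ⇨ p ⇨ 0) :=
  imp_swap (.ax (.hl10 p))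

theorem imp_zero_imp_neg (p : Formula ℕ) : Derives Γ ((p ⇨ 0) ⇨ pᶜ) := by
  have zero_imp_neg_one : Derives Γ (0 ⇨ 1ᶜ) := .mp (one_imp_iff.2 (.ax .hl11)) (.ax (.hl5 1 0))
  have imp_neg_one_imp : Derives Γ ((p ⇨ 1ᶜ) ⇨ 1 ⇨ pᶜ) := .ax (.hl5 p 1)
  have one_imp_neg_imp : Derives Γ ((1 ⇨ pᶜ) ⇨ pᶜ) := .mp (.ax .hl8) (imp_swap (imp_self _))
  exact (imp_mono (imp_self p) zero_imp_neg_one).imp_trans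
    (imp_neg_one_imp.imp_trans one_imp_neg_imp)

theorem imp_imp_zero_imp_zero (p : Formula ℕ) : Derives Γ (p ⇨ (p ⇨ 0) ⇨ 0) :=
  imp_swap (imp_self _)

theorem imp_zero_imp_zero_imp (p : Formula ℕ) : Derives Γ (((p ⇨ 0) ⇨ 0) ⇨ p) :=
  (imp_mono (neg_imp_imp_zero p) (imp_self 0)).imp_trans
    ((imp_zero_imp_neg _).imp_trans (.ax (.hl4 p)))

theorem top_imp_zero_imp_bot : Derives Γ ((⊤ ⇨ 0) ⇨ ⊥) :=
  (imp_mono (.ax (.hl18 (⊥ ⇨ 0))) (imp_self 0)).imp_trans (imp_zero_imp_zero_imp ⊥)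

end Derives

/-- Interderivability of formulas over `Γ`, which identifies formulas in the Lindenbaum algebra.
Formulas are lifted to the universe `u` because completeness is needed there. -/
def interderivable (Γ : Set (Formula ℕ)) : Setoid (ULift.{u} (Formula ℕ)) where
  r p q := Derives Γ (p.down ⇨ q.down) ∧ Derives Γ (q.down ⇨ p.down)
  iseqv := ⟨fun _ => ⟨.imp_self _, .imp_self _⟩, And.symm,
    fun h k => ⟨h.1.imp_trans k.1, k.2.imp_trans h.2⟩⟩

/-- The Lindenbaum algebra of the theory generated by `Γ`: formulas modulo interderivability over
`Γ`, ordered by derivability of the implication. -/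
def Lindenbaum (Γ : Set (Formula ℕ)) : Type u :=
  Quotient (interderivable.{u} Γ)

namespace Lindenbaum

variable {Γ : Set (Formula ℕ)}

/-- The class of a formula in the Lindenbaum algebra. -/
def mk (Γ : Set (Formula ℕ)) (p : Formula ℕ) : Lindenbaum.{u} Γ :=
  Quotient.mk _ ⟨p⟩

theorem ind {P : Lindenbaum.{u} Γ → Prop} (h : ∀ p, P (mk Γ p)) (a : Lindenbaum.{u} Γ) : P a :=
  Quotient.ind (fun p => h p.down) a

theorem mk_eq_mk {p q : Formula ℕ} (h₁ : Derives Γ (p ⇨ q)) (h₂ : Derives Γ (q ⇨ p)) :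
    mk.{u} Γ p = mk Γ q :=
  Quotient.sound ⟨h₁, h₂⟩

instance : PartialOrder (Lindenbaum.{u} Γ) where
  le := Quotient.lift₂ (fun p q => Derives Γ (p.down ⇨ q.down)) fun _ _ _ _ h k => propext
    ⟨fun H => h.2.imp_trans (H.imp_trans k.1), fun H => h.1.imp_trans (H.imp_trans k.2)⟩
  le_refl := ind fun p => .imp_self p
  le_trans := ind fun _ => ind fun _ => ind fun _ => Derives.imp_trans
  le_antisymm := ind fun _ => ind fun _ => mk_eq_mk

instance : Lattice (Lindenbaum.{u} Γ) where
  inf := Quotient.map₂ (fun p q => ⟨p.down ⊓ q.down⟩) fun _ _ h _ _ k =>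
    ⟨.meet_mono h.1 k.1, .meet_mono h.2 k.2⟩
  sup := Quotient.map₂ (fun p q => ⟨p.down ⊔ q.down⟩) fun _ _ h _ _ k =>
    ⟨.join_mono h.1 k.1, .join_mono h.2 k.2⟩
  inf_le_left := ind fun p => ind fun q => .ax (.hl12 p q)
  inf_le_right := ind fun p => ind fun q => .ax (.hl13 p q)
  le_inf := ind fun _ => ind fun _ => ind fun _ => Derives.imp_meet
  le_sup_left := ind fun p => ind fun q => .ax (.hl15 p q)
  le_sup_right := ind fun p => ind fun q => .ax (.hl16 p q)
  sup_le := ind fun _ => ind fun _ => ind fun _ => Derives.join_imp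

instance : CommMagma (Lindenbaum.{u} Γ) where
  mul := Quotient.map₂ (fun p q => ⟨p.down * q.down⟩) fun _ _ h _ _ k =>
    ⟨.mul_mono h.1 k.1, .mul_mono h.2 k.2⟩
  mul_comm := ind fun p => ind fun q => mk_eq_mk (.mul_comm p q) (.mul_comm q p)

instance : One (Lindenbaum.{u} Γ) := ⟨mk Γ 1⟩

protected theorem mul_one : ∀ a : Lindenbaum.{u} Γ, a * 1 = a :=
  ind fun p => mk_eq_mk (.mul_one_imp p) (.imp_mul_one p)

instance : CommMonoid (Lindenbaum.{u} Γ) where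
  mul_assoc := ind fun _ => ind fun _ => ind fun _ =>
    mk_eq_mk (Derives.mul_mul_imp_iff.2 (.imp_self _)) (Derives.mul_mul_imp_iff.1 (.imp_self _))
  mul_one := Lindenbaum.mul_one
  one_mul a := by rw [mul_comm, Lindenbaum.mul_one]
  mul_comm := mul_comm

instance : BoundedGirardAlgebra (Lindenbaum.{u} Γ) where
  himp := Quotient.map₂ (fun p q => ⟨p.down ⇨ q.down⟩) fun _ _ h _ _ k =>
    ⟨.imp_mono h.2 k.1, .imp_mono h.1 k.2⟩
  residuation := ind fun _ => ind fun _ => ind fun _ =>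
    ⟨fun h => (Derives.mul_imp_iff.1 h).imp_swap, fun h => Derives.mul_imp_iff.2 h.imp_swap⟩
  zero := mk Γ 0
  involutive := ind fun p => mk_eq_mk (.imp_zero_imp_zero_imp p) (.imp_imp_zero_imp_zero p)
  top := mk Γ ⊤
  one_le_himp_top := ind fun p => Derives.one_imp_iff.2 (.ax (.hl18 p))

theorem one_le_mk_iff {p : Formula ℕ} : 1 ≤ mk.{u} Γ p ↔ Derives Γ p :=
  Derives.one_imp_iff

end Lindenbaum

end MALL

namespace BoundedGirardAlgebra

open FirstOrder.Language MALL

variable {A : Type u} [B : BoundedGirardAlgebra A] {α : Type}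

/-- The value of a formula in a bounded Girard algebra, with `¬x` read as `x ⇨ 0` and `⊥` as
`⊤ ⇨ 0`. -/
def eval (v : α → A) (p : Formula α) : A :=
  @Term.realize lang A B.mallStructure α v p

variable (v : α → A) (p q : Formula α)

@[simp] theorem eval_var (a : α) : eval v (Formula.var a) = v a := rfl
@[simp] theorem eval_zero : eval v (0 : Formula α) = 0 := rfl
@[simp] theorem eval_one : eval v (1 : Formula α) = 1 := rfl
@[simp] theorem eval_top : eval v (⊤ : Formula α) = ⊤ := rfl
@[simp] theorem eval_bot : eval v (⊥ : Formula α) = ⊤ ⇨ 0 := rfl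
@[simp] theorem eval_neg : eval v pᶜ = eval v p ⇨ 0 := rfl
@[simp] theorem eval_mul : eval v (p * q) = eval v p * eval v q := rfl
@[simp] theorem eval_imp : eval v (p ⇨ q) = eval v p ⇨ eval v q := rfl
@[simp] theorem eval_meet : eval v (p ⊓ q) = eval v p ⊓ eval v q := rfl
@[simp] theorem eval_join : eval v (p ⊔ q) = eval v p ⊔ eval v q := rfl

end BoundedGirardAlgebra

namespace MALL

open FirstOrder.Language BoundedGirardAlgebra CommResiduatedLattice

section Soundness

variable {A : Type u} [BoundedGirardAlgebra A] {Γ : Set (Formula ℕ)} {p : Formula ℕ}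

theorem IsAxiom.one_le_eval (h : IsAxiom p) (v : ℕ → A) : 1 ≤ eval v p := by
  cases h <;> simp only [eval_zero, eval_one, eval_top, eval_bot, eval_neg, eval_mul, eval_imp,
    eval_meet, eval_join, one_le_himp_iff, le_refl, inf_le_left, inf_le_right, le_sup_left,
    le_sup_right, le_top, top_himp_zero_le]
  case hl2 p q r => exact himp_le_himp_himp _ _ _
  case hl3 p q r => exact (CommResiduatedLattice.himp_left_comm _ _ _).le
  case hl4 p => exact (GirardAlgebra.involutive _).le
  case hl5 p q => exact (CommResiduatedLattice.himp_left_comm _ _ _).le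
  case hl6 p q => exact le_himp_iff_le_himp.1 (le_himp_iff_mul_le.2 le_rfl)
  case hl7 p q r => exact (mul_himp _ _ _).ge
  case hl10 p => exact (GirardAlgebra.involutive _).ge
  case hl14 p q r => exact (CommResiduatedLattice.himp_inf_distrib _ _ _).ge
  case hl17 p q r => exact (CommResiduatedLattice.sup_himp_distrib _ _ _).ge

theorem Derives.one_le_eval (h : Derives Γ p) (v : ℕ → A) (hv : ∀ γ ∈ Γ, 1 ≤ eval v γ) :
    1 ≤ eval v p := by
  induction h with
  | hyp h => exact hv _ h
  | ax h => exact h.one_le_eval v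
  | mp _ _ one_le_p one_le_imp => exact one_le_p.trans (one_le_himp_iff.1 one_le_imp)
  | adj _ _ one_le_p one_le_q => exact le_inf one_le_p one_le_q

end Soundness

theorem Lindenbaum.eval_mk_var (Γ : Set (Formula ℕ)) (p : Formula ℕ) :
    eval (fun n => mk.{u} Γ (.var n)) p = mk Γ p := by
  induction p using Formula.induction with
  | var n => rfl
  | zero => rfl
  | one => rfl
  | top => rfl
  | bot => exact mk_eq_mk .top_imp_zero_imp_bot (.ax (.hl19 _))
  | neg p hp => rw [eval_neg, hp]; exact mk_eq_mk (.imp_zero_imp_neg p) (.neg_imp_imp_zero p)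
  | mul p q hp hq => rw [eval_mul, hp, hq]; rfl
  | imp p q hp hq => rw [eval_imp, hp, hq]; rfl
  | meet p q hp hq => rw [eval_meet, hp, hq]; rfl
  | join p q hp hq => rw [eval_join, hp, hq]; rfl

theorem derives_iff_forall_one_le_eval {Γ : Set (Formula ℕ)} {p : Formula ℕ} :
    Derives Γ p ↔ ∀ (A : Type u) [BoundedGirardAlgebra A] (v : ℕ → A),
      (∀ γ ∈ Γ, 1 ≤ eval v γ) → 1 ≤ eval v p := by
  refine ⟨fun h A _ v => h.one_le_eval v, fun h => ?_⟩
  have canonical := h (Lindenbaum.{u} Γ) fun n => .mk Γ (.var n)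
  simp only [Lindenbaum.eval_mk_var, Lindenbaum.one_le_mk_iff] at canonical
  exact canonical fun _ => .hyp

section Semantics

variable {A : Type u} [B : BoundedGirardAlgebra A] {a b : A}

theorem isDesignated_definingEquations_iff :
    letI := B.mallStructure; AAL.IsDesignated definingEquations a ↔ 1 ≤ a := by
  let := B.mallStructure
  simp only [AAL.IsDesignated, definingEquations, Set.mem_singleton_iff, forall_eq]
  exact inf_eq_right

theorem eq_iff_forall_congruenceFormulas_one_le_eval :
    a = b ↔ ∀ d ∈ congruenceFormulas, 1 ≤ eval ![a, b] d := by
  simp [congruenceFormulas, one_le_himp_iff, le_antisymm_iff]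

end Semantics

theorem isEquivalentAlgebraicSemantics_asClass :
    AAL.IsEquivalentAlgebraicSemantics system asClass.{u} definingEquations congruenceFormulas := by
  refine .of_isDesignated (Set.finite_singleton _) (Set.toFinite {_, _}) (fun Γ p => ?_) ?_
  · refine derives_iff_forall_one_le_eval.{u}.trans ⟨?_, fun h A B v => ?_⟩
    · rintro h A _ ⟨B, rfl⟩ v
      simp only [isDesignated_definingEquations_iff]
      exact h A v
    · let := B.mallStructure
      have one_le_realize := h A ⟨B, rfl⟩ v
      simp only [isDesignated_definingEquations_iff] at one_le_realize
      exact one_le_realize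
  · rintro A _ ⟨B, rfl⟩ a b
    simp only [isDesignated_definingEquations_iff]
    exact eq_iff_forall_congruenceFormulas_one_le_eval

end MALL

namespace BoundedGirardAlgebra

/-- A bounded Girard algebra from operations that satisfy equational laws, of which
`sup_himp_mul_sup` and `mul_himp_inf_sup` together express residuation. -/
abbrev ofIdentities {A : Type u} [Zero A] [One A] [Top A] [Mul A] [HImp A] [Min A] [Max A]
    (sup_comm : ∀ a b : A, a ⊔ b = b ⊔ a) (sup_assoc : ∀ a b c : A, a ⊔ b ⊔ c = a ⊔ (b ⊔ c))
    (inf_comm : ∀ a b : A, a ⊓ b = b ⊓ a) (inf_assoc : ∀ a b c : A, a ⊓ b ⊓ c = a ⊓ (b ⊓ c))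
    (sup_inf_self : ∀ a b : A, a ⊔ a ⊓ b = a) (inf_sup_self : ∀ a b : A, a ⊓ (a ⊔ b) = a)
    (mul_comm : ∀ a b : A, a * b = b * a) (mul_assoc : ∀ a b c : A, a * b * c = a * (b * c))
    (mul_one : ∀ a : A, a * 1 = a)
    (sup_himp_mul_sup : ∀ a b c : A, b ⊔ (a ⇨ a * b ⊔ c) = a ⇨ a * b ⊔ c)
    (mul_himp_inf_sup : ∀ a b c : A, a * ((a ⇨ c) ⊓ b) ⊔ c = c)
    (himp_zero_himp_zero : ∀ a : A, (a ⇨ 0) ⇨ 0 = a)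
    (one_sup_himp_top : ∀ a : A, 1 ⊔ (a ⇨ ⊤) = a ⇨ ⊤) : BoundedGirardAlgebra A where
  __ := Lattice.mk' sup_comm sup_assoc inf_comm inf_assoc sup_inf_self inf_sup_self
  mul_comm := mul_comm
  mul_assoc := mul_assoc
  mul_one := mul_one
  one_mul a := (mul_comm 1 a).trans (mul_one a)
  residuation a b c := by
    let := Lattice.mk' sup_comm sup_assoc inf_comm inf_assoc sup_inf_self inf_sup_self
    constructor <;> intro h
    · have le_himp := sup_himp_mul_sup a b c
      rw [sup_eq_right.2 h] at le_himp
      exact sup_eq_right.1 le_himp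
    · have mul_le := mul_himp_inf_sup a b c
      rw [inf_eq_right.2 h] at mul_le
      exact sup_eq_right.1 mul_le
  involutive := himp_zero_himp_zero
  one_le_himp_top := one_sup_himp_top

end BoundedGirardAlgebra

namespace MALL

open FirstOrder.Language BoundedGirardAlgebra CommResiduatedLattice

/-- The identities that axiomatize bounded Girard algebras in the language of MALL. Residuation is
expressed by `le_imp_mul_join` and `mul_imp_meet_le`, in which an inequality `s ≤ t` is written as
`s ⊔ t ≈ t`. -/
inductive IsGirardIdentity {α : Type} : AAL.Equation lang α → Prop
  | join_comm (p q : Formula α) : IsGirardIdentity ⟨p ⊔ q, q ⊔ p⟩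
  | join_assoc (p q r : Formula α) : IsGirardIdentity ⟨p ⊔ q ⊔ r, p ⊔ (q ⊔ r)⟩
  | meet_comm (p q : Formula α) : IsGirardIdentity ⟨p ⊓ q, q ⊓ p⟩
  | meet_assoc (p q r : Formula α) : IsGirardIdentity ⟨p ⊓ q ⊓ r, p ⊓ (q ⊓ r)⟩
  | join_meet_self (p q : Formula α) : IsGirardIdentity ⟨p ⊔ p ⊓ q, p⟩
  | meet_join_self (p q : Formula α) : IsGirardIdentity ⟨p ⊓ (p ⊔ q), p⟩
  | mul_comm (p q : Formula α) : IsGirardIdentity ⟨p * q, q * p⟩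
  | mul_assoc (p q r : Formula α) : IsGirardIdentity ⟨p * q * r, p * (q * r)⟩
  | mul_one (p : Formula α) : IsGirardIdentity ⟨p * 1, p⟩
  | le_imp_mul_join (p q r : Formula α) :
    IsGirardIdentity ⟨q ⊔ (p ⇨ p * q ⊔ r), p ⇨ p * q ⊔ r⟩
  | mul_imp_meet_le (p q r : Formula α) : IsGirardIdentity ⟨p * ((p ⇨ r) ⊓ q) ⊔ r, r⟩
  | imp_zero_imp_zero (p : Formula α) : IsGirardIdentity ⟨(p ⇨ 0) ⇨ 0, p⟩
  | one_le_imp_top (p : Formula α) : IsGirardIdentity ⟨1 ⊔ (p ⇨ ⊤), p ⇨ ⊤⟩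
  | neg_eq (p : Formula α) : IsGirardIdentity ⟨pᶜ, p ⇨ 0⟩
  | bot_eq : IsGirardIdentity ⟨⊥, ⊤ ⇨ 0⟩

protected theorem IsGirardIdentity.eval_eq {α : Type} {e : AAL.Equation lang α}
    (he : IsGirardIdentity e) {A : Type u} [BoundedGirardAlgebra A] (v : α → A) :
    eval v e.lhs = eval v e.rhs := by
  cases he <;> simp only [eval_zero, eval_one, eval_top, eval_bot, eval_neg, eval_mul, eval_imp,
    eval_meet, eval_join, sup_inf_self, inf_sup_self, sup_assoc, inf_assoc, _root_.mul_one,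
    _root_.mul_assoc, GirardAlgebra.involutive, sup_eq_right, one_le_himp_iff, le_top]
  case join_comm p q => exact sup_comm _ _
  case meet_comm p q => exact inf_comm _ _
  case mul_comm p q => exact _root_.mul_comm _ _
  case le_imp_mul_join p q r => exact le_himp_iff_mul_le.2 le_sup_left
  case mul_imp_meet_le p q r => exact le_himp_iff_mul_le.1 inf_le_left

namespace Interpretation

variable {A : Type u} [lang.Structure A]

local instance : Zero A := ⟨Structure.funMap (L := lang) (n := 0) Connective.zero ![]⟩
local instance : One A := ⟨Structure.funMap (L := lang) (n := 0) Connective.one ![]⟩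
local instance : Top A := ⟨Structure.funMap (L := lang) (n := 0) Connective.top ![]⟩
local instance : Bot A := ⟨Structure.funMap (L := lang) (n := 0) Connective.bot ![]⟩
local instance : Compl A := ⟨fun a => Structure.funMap (L := lang) (n := 1) Connective.neg ![a]⟩
local instance : Mul A := ⟨fun a b => Structure.funMap (L := lang) (n := 2) Connective.mul ![a, b]⟩
local instance : HImp A := ⟨fun a b => Structure.funMap (L := lang) (n := 2) Connective.imp ![a, b]⟩
local instance : Min A := ⟨fun a b => Structure.funMap (L := lang) (n := 2) Connective.meet ![a, b]⟩
local instance : Max A := ⟨fun a b => Structure.funMap (L := lang) (n := 2) Connective.join ![a, b]⟩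

variable {α : Type} (v : α → A) (p q : Formula α)

theorem realize_var (a : α) : (Formula.var a).realize v = v a := rfl

theorem realize_zero : (0 : Formula α).realize v = 0 :=
  congrArg (Structure.funMap _) (Subsingleton.elim _ _)

theorem realize_one : (1 : Formula α).realize v = 1 :=
  congrArg (Structure.funMap _) (Subsingleton.elim _ _)

theorem realize_top : (⊤ : Formula α).realize v = ⊤ :=
  congrArg (Structure.funMap _) (Subsingleton.elim _ _)

theorem realize_bot : (⊥ : Formula α).realize v = ⊥ :=
  congrArg (Structure.funMap _) (Subsingleton.elim _ _)

theorem realize_neg : pᶜ.realize v = (p.realize v)ᶜ :=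
  Term.realize_functions_apply₁

theorem realize_mul : (p * q).realize v = p.realize v * q.realize v :=
  Term.realize_functions_apply₂

theorem realize_imp : (p ⇨ q).realize v = p.realize v ⇨ q.realize v :=
  Term.realize_functions_apply₂

theorem realize_meet : (p ⊓ q).realize v = p.realize v ⊓ q.realize v :=
  Term.realize_functions_apply₂

theorem realize_join : (p ⊔ q).realize v = p.realize v ⊔ q.realize v :=
  Term.realize_functions_apply₂

attribute [local simp] realize_var realize_zero realize_one realize_top realize_bot realize_neg
  realize_mul realize_imp realize_meet realize_join

theorem asClass_of_isGirardIdentity_imp_holds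
    (hA : ∀ e : AAL.Equation lang (Fin 3), IsGirardIdentity e → ∀ v : Fin 3 → A, e.Holds v) :
    asClass A := by
  have laws {s t : Formula (Fin 3)} (h : IsGirardIdentity ⟨s, t⟩) (a b c : A) :
      s.realize ![a, b, c] = t.realize ![a, b, c] := hA _ h _
  let B : BoundedGirardAlgebra A := ofIdentities
    (fun a b => by simpa using laws (.join_comm (.var 0) (.var 1)) a b b)
    (fun a b c => by simpa using laws (.join_assoc (.var 0) (.var 1) (.var 2)) a b c)
    (fun a b => by simpa using laws (.meet_comm (.var 0) (.var 1)) a b b)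
    (fun a b c => by simpa using laws (.meet_assoc (.var 0) (.var 1) (.var 2)) a b c)
    (fun a b => by simpa using laws (.join_meet_self (.var 0) (.var 1)) a b b)
    (fun a b => by simpa using laws (.meet_join_self (.var 0) (.var 1)) a b b)
    (fun a b => by simpa using laws (.mul_comm (.var 0) (.var 1)) a b b)
    (fun a b c => by simpa using laws (.mul_assoc (.var 0) (.var 1) (.var 2)) a b c)
    (fun a => by simpa using laws (.mul_one (.var 0)) a a a)
    (fun a b c => by simpa using laws (.le_imp_mul_join (.var 0) (.var 1) (.var 2)) a b c)
    (fun a b c => by simpa using laws (.mul_imp_meet_le (.var 0) (.var 1) (.var 2)) a b c)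
    (fun a => by simpa using laws (.imp_zero_imp_zero (.var 0)) a a a)
    (fun a => by simpa using laws (.one_le_imp_top (.var 0)) a a a)
  have neg_eq (a : A) : aᶜ = a ⇨ 0 := by simpa using laws (.neg_eq (.var 0)) a a a
  have bot_eq (a : A) : (⊥ : A) = ⊤ ⇨ 0 := by simpa using laws .bot_eq a a a
  refine ⟨B, structure_ext ?_ ?_ ?_⟩
  · rintro (_ | _ | _ | _)
    exacts [rfl, rfl, rfl, bot_eq 1]
  · rintro ⟨⟩ a
    exact neg_eq a
  · rintro (_ | _ | _ | _) a b <;> rfl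

end Interpretation

theorem isVariety_asClass : AAL.IsVariety asClass.{u} := by
  refine AAL.isVariety_of_countable {e : AAL.Equation lang (Fin 3) | IsGirardIdentity e}
    fun A _ => ⟨?_, Interpretation.asClass_of_isGirardIdentity_imp_holds⟩
  rintro ⟨B, rfl⟩ e he v
  exact he.eval_eq v

end MALL

/-- MALL is algebraizable; the bounded Girard algebras form a variety, which is an equivalent
algebraic semantics of MALL with defining equation `p ∧ 1 ≈ 1` and congruence formulas `p → q`,
`q → p`, and it is the only quasivariety that is an equivalent algebraic semantics of MALL (with
respect to any finite sets of defining equations and equivalence formulas). -/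
theorem mainTheorem2 :
    AAL.Algebraizable.{u} MALL.system ∧
    AAL.IsVariety BoundedGirardAlgebra.asClass.{u} ∧
    AAL.IsEquivalentAlgebraicSemantics MALL.system BoundedGirardAlgebra.asClass.{u}
      MALL.definingEquations MALL.congruenceFormulas ∧
    ∀ K : AAL.AlgebraClass.{u} MALL.lang, AAL.IsQuasivariety K →
      (∃ (τ : Set (AAL.Equation MALL.lang (Fin 1))) (Δ : Set (MALL.Formula (Fin 2))),
        AAL.IsEquivalentAlgebraicSemantics MALL.system K τ Δ) →
      ∀ (A : Type u) [MALL.lang.Structure A], K A ↔ BoundedGirardAlgebra.asClass A :=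
  ⟨⟨_, _, _, MALL.isEquivalentAlgebraicSemantics_asClass⟩, MALL.isVariety_asClass,
    MALL.isEquivalentAlgebraicSemantics_asClass, fun _ hK ⟨_, _, h⟩ A _ =>
      h.iff_of_isQuasivariety MALL.isEquivalentAlgebraicSemantics_asClass hK
        MALL.isVariety_asClass.isQuasivariety A⟩
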